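/- **Theorem (existence of an optimal solution and continuity over the distribution).** Let $(\Xi_k,\rho_k)$, $k=1,\dots,n$, be proper metric spaces (closed bounded sets are compact), let $\Xi:=\Xi_1\times\cdots\times\Xi_n$, and let $\rho$ be a metric on $\Xi$ that is equivalent to the product metric $d_q:=(\sum_{k=1}^n\rho_k^q)^{1/q}$ for some $q\in[1,\infty]$ (with $d_\infty=\max_k\rho_k$), that is, $c\,d_q\le\rho\le C\,d_q$ for some constants $c,C>0$. Let $p\ge 1$, let $\varepsilon_1,\dots,\varepsilon_n\ge 0$, and let $Q$ be a Borel probability measure on $\Xi$ with finite $p$-th moment, i.e. $\int\rho(\zeta,\xi)^p\,dQ(\xi)<\infty$ for some $\zeta\in\Xi$. Denote by $\mathcal P_p(\Xi)$ the set of all Borel probability measures on $\Xi$ with finite $p$-th moment, and let $\mathcal T_p(Q,\varepsilon)$ be the set of second marginals of all Borel probability measures $\pi$ on $\Xi\times\Xi$ whose first marginal is $Q$ and which satisfy $$\int_{\Xi\times\Xi}\rho_k(\zeta_k,\xi_k)^p\,d\pi(\zeta,\xi)\le\varepsilon_k^p\qquad\text{for all }k=1,\dots,n.$$ For $r\ge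 0$, let $\mathcal G_r^{\rm up}$ be the set of all functions $h:\Xi\to\mathbb R$ for which there are $C>0$ and $\zeta\in\Xi$ with $h(\xi)\le C(1+\rho(\zeta,\xi)^r)$ for all $\xi\in\Xi$, and let $\mathcal G_r$ be the set of all $h$ with $h\in\mathcal G_r^{\rm up}$ and $-h\in\mathcal G_r^{\rm up}$. Then: (i) If $h\in\mathcal G_r^{\rm up}$ for some $r\in[0,p)$ and $h$ is upper semicontinuous, then $\mathbb E_P[\max\{h,0\}]<\infty$ for every $P\in\mathcal T_p(Q,\varepsilon)$, so that $\mathbb E_P[h]\in[-\infty,\infty)$ is well defined, and the supremum $\sup_{P\in\mathcal T_p(Q,\varepsilon)}\mathbb E_P[h]$ is attained: there is $P^\star\in\mathcal T_p(Q,\varepsilon)$ with $\mathbb E_{P^\star}[h]=\sup_{P\in\mathcal T_p(Q,\varepsilon)}\mathbb E_P[h]$. (ii) If $h\in\mathcal G_r$ for some $r\in[0,p)$ and $h$ is continuous, then $h$ is integrable with respect to every $P\in\mathcal P_p(\Xi)$, $\mathcal T_p(Q,\varepsilon)\subset\mathcal P_p(\Xi)$, and the map $P\mapsto\mathbb E_P[h]$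 from $\mathcal P_p(\Xi)$ to $\mathbb R$ is continuous on $\mathcal T_p(Q,\varepsilon)$ with respect to the topology of weak convergence of probability measures. -/

import Mathlib

open MeasureTheory
open scoped ENNReal

namespace MTH

section Metric

variable {n : ℕ} {Ξ : Fin n → Type*} [∀ k, MetricSpace (Ξ k)]

/-- The `ℓ^q` product distance `(∑ k, ρ_k(x_k, y_k)^q)^(1/q)` on `Ξ = Ξ_1 × ⋯ × Ξ_n`, which is
`max_k ρ_k(x_k, y_k)` for `q = ∞`. -/
noncomputable def productDist (q : ℝ≥0∞) (x y : (k : Fin n) → Ξ k) : ℝ :=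
  dist (WithLp.toLp q x : PiLp q Ξ) (WithLp.toLp q y)

theorem productDist_top (x y : (k : Fin n) → Ξ k) :
    productDist ∞ x y = ⨆ k, dist (x k) (y k) :=
  PiLp.dist_eq_iSup _ _

theorem productDist_of_ne_top {q : ℝ≥0∞} (hq : 1 ≤ q) (hq' : q ≠ ∞)
    (x y : (k : Fin n) → Ξ k) :
    productDist q x y = (∑ k, dist (x k) (y k) ^ q.toReal) ^ (1 / q.toReal) :=
  PiLp.dist_eq_sum (ENNReal.toReal_pos (zero_lt_one.trans_le hq).ne' hq') _ _

/-- The metric `ρ` on `Ξ = Ξ_1 × ⋯ × Ξ_n` is (Lipschitz) equivalent to the `ℓ^q` product metric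
for some `q ∈ [1, ∞]`. -/
def EquivProductMetric (ρ : MetricSpace ((k : Fin n) → Ξ k)) : Prop :=
  ∃ q : ℝ≥0∞, 1 ≤ q ∧ ∃ c C : ℝ, 0 < c ∧ 0 < C ∧
    ∀ x y, c * productDist q x y ≤ ρ.dist x y ∧ ρ.dist x y ≤ C * productDist q x y

theorem topology_eq_induced_of_dist_bounds {α β : Type*} (ρ : MetricSpace α) [MetricSpace β] (f : α → β)
    (c C : ℝ) (hc : 0 < c) (hC : 0 < C)
    (H : ∀ x y, c * dist (f x) (f y) ≤ dist x y ∧ dist x y ≤ C * dist (f x) (f y)) :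
    ρ.toPseudoMetricSpace.toUniformSpace.toTopologicalSpace =
      TopologicalSpace.induced f inferInstance := by
  have hl : LipschitzWith (Real.toNNReal c⁻¹) f := by
    refine LipschitzWith.of_dist_le_mul fun x y => ?_
    rw [Real.coe_toNNReal _ (inv_pos.2 hc).le, inv_mul_eq_div, le_div_iff₀ hc, mul_comm]
    exact (H x y).1
  have ha : AntilipschitzWith (Real.toNNReal C) f := by
    refine AntilipschitzWith.of_le_mul_dist fun x y => ?_
    rw [Real.coe_toNNReal _ hC.le]
    exact (H x y).2
  exact (ha.isUniformInducing hl.uniformContinuous).isInducing.eq_induced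

/-- Such a metric induces the product topology. Hence continuity, semicontinuity, the Borel
`σ`-algebra and weak convergence on `(Ξ, ρ)` are those of Mathlib's product space `Ξ`. -/
theorem EquivProductMetric.topology_eq {ρ : MetricSpace ((k : Fin n) → Ξ k)}
    (h : EquivProductMetric ρ) :
    ρ.toPseudoMetricSpace.toUniformSpace.toTopologicalSpace =
      (Pi.topologicalSpace : TopologicalSpace ((k : Fin n) → Ξ k)) := by
  obtain ⟨q, hq, c, C, hc, hC, H⟩ := h
  have : Fact (1 ≤ q) := ⟨hq⟩
  have h1 := topology_eq_induced_of_dist_bounds ρ (fun x => (WithLp.toLp q x : PiLp q Ξ)) c C hc hC H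
  have h2 : Topology.IsInducing (fun x : (k : Fin n) → Ξ k => (WithLp.toLp q x : PiLp q Ξ)) :=
    (PiLp.homeomorph q Ξ).symm.isInducing
  exact h1.trans h2.eq_induced.symm

end Metric

section Growth

variable {X : Type*}

/-- The class `𝒢_r^up`: `h ≤ C (1 + ρ(ζ, ·)^r)` for some `C > 0` and some point `ζ`. -/
def GrowthUp (ρ : MetricSpace X) (r : ℝ) (h : X → ℝ) : Prop :=
  ∃ C : ℝ, 0 < C ∧ ∃ ζ : X, ∀ ξ : X, h ξ ≤ C * (1 + ρ.dist ζ ξ ^ r)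

/-- The class `𝒢_r`: both `h` and `-h` belong to `𝒢_r^up`. -/
def Growth (ρ : MetricSpace X) (r : ℝ) (h : X → ℝ) : Prop :=
  GrowthUp ρ r h ∧ GrowthUp ρ r (fun ξ => - h ξ)

/-- `P` has a finite `p`-th moment with respect to `ρ`, that is, `P ∈ 𝒫_p(Ξ)`. -/
def FiniteMoment [MeasurableSpace X] (ρ : MetricSpace X) (p : ℝ) (P : ProbabilityMeasure X) :
    Prop :=
  ∃ ζ : X, ∫⁻ ξ, ENNReal.ofReal (ρ.dist ζ ξ ^ p) ∂(P : Measure X) < ∞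

/-- The extended-real expectation `E_P[h] = E_P[h⁺] - E_P[h⁻]`. It is used only where
`E_P[h⁺] < ∞`, and may equal `-∞`. -/
noncomputable def extExpectation [MeasurableSpace X] (P : ProbabilityMeasure X) (h : X → ℝ) :
    EReal :=
  ((∫⁻ ξ, ENNReal.ofReal (h ξ) ∂(P : Measure X) : ℝ≥0∞) : EReal) -
    ((∫⁻ ξ, ENNReal.ofReal (- h ξ) ∂(P : Measure X) : ℝ≥0∞) : EReal)

end Growth

/-- The multi-transport hyperrectangle `𝒯_p(Q, ε)`: second marginals of the probability measures
`π` on `Ξ × Ξ` with first marginal `Q` and `∫ ρ_k(ζ_k, ξ_k)^p dπ(ζ, ξ) ≤ ε_k^p` for every `k`. -/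
def hyperrectangle {n : ℕ} {Ξ : Fin n → Type*} [∀ k, MetricSpace (Ξ k)]
    [∀ k, MeasurableSpace (Ξ k)] (p : ℝ) (Q : ProbabilityMeasure ((k : Fin n) → Ξ k))
    (ε : Fin n → ℝ) : Set (ProbabilityMeasure ((k : Fin n) → Ξ k)) :=
  {P | ∃ π : ProbabilityMeasure (((k : Fin n) → Ξ k) × ((k : Fin n) → Ξ k)),
    π.map measurable_fst.aemeasurable = Q ∧ π.map measurable_snd.aemeasurable = P ∧
    ∀ k, ∫⁻ z, ENNReal.ofReal (dist (z.1 k) (z.2 k) ^ p)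
      ∂(π : Measure (((k : Fin n) → Ξ k) × ((k : Fin n) → Ξ k))) ≤ ENNReal.ofReal (ε k ^ p)}

end MTH

namespace MTH

/-! ### Weak convergence: semicontinuity of integrals and tightness. -/

open Filter Topology TopologicalSpace

/-! Since `ρ` is equivalent to the maximum metric, growth and moment conditions can be tested with
`maxDist` at one fixed base point. The hyperrectangle is the continuous image, under the second
marginal, of the set `couplings`. That set is weakly closed, as transport costs are lower
semicontinuous, and tight: the triangle inequality bounds the `p`-th moments of all second marginals
uniformly, and closed balls are compact. By Prokhorov both sets are compact.

A uniform `p`-th moment bound makes functions of growth order `r < p` uniformly integrable, so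
expectations of continuous ones are weakly continuous (`continuousOn_integral_of_moment_le`); this
is (ii). For (i), `h` lies below the continuous `g = C (1 + d^r)`, and `E[h] = E[g] - E[g - h]` is a
continuous term minus a lower semicontinuous one. An upper semicontinuous function attains its
maximum on a nonempty compact set. -/

/-- The integral of a nonnegative lower semicontinuous function is lower semicontinuous with
respect to weak convergence. -/
theorem lowerSemicontinuous_lintegral_ofReal {X : Type*} [TopologicalSpace X]
    [PseudoMetrizableSpace X] [SeparableSpace X] [MeasurableSpace X] [BorelSpace X]
    {f : X → ℝ} (hf : LowerSemicontinuous f) (h0 : ∀ x, 0 ≤ f x) :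
    LowerSemicontinuous fun P : ProbabilityMeasure X =>
      ∫⁻ x, ENNReal.ofReal (f x) ∂(P : Measure X) := by
  rw [lowerSemicontinuous_iff_le_liminf]
  intro P
  -- Layer cake reduces the claim to the open superlevel sets, where the portmanteau theorem
  -- applies; Fatou's lemma then moves the `liminf` outside the integral over levels.
  simp_rw [lintegral_eq_lintegral_meas_lt _ (Eventually.of_forall h0) hf.measurable.aemeasurable]
  calc ∫⁻ t in Set.Ioi (0 : ℝ), (P : Measure X) {a | t < f a}
      ≤ ∫⁻ t in Set.Ioi (0 : ℝ),
          (𝓝 P).liminf (fun R : ProbabilityMeasure X => (R : Measure X) {a | t < f a}) :=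
        lintegral_mono fun t =>
          ProbabilityMeasure.le_liminf_measure_open_of_tendsto tendsto_id (hf.isOpen_preimage t)
    _ ≤ _ := lintegral_liminf_le fun R => Antitone.measurable fun s t hst =>
          measure_mono fun x (hx : t < f x) => lt_of_le_of_lt hst hx

theorem ofReal_dist_rpow {X : Type*} [PseudoMetricSpace X] {p : ℝ} (hp : 0 ≤ p) (x y : X) :
    ENNReal.ofReal (dist x y ^ p) = edist x y ^ p := by
  rw [edist_dist, ENNReal.ofReal_rpow_of_nonneg dist_nonneg hp]

/-- In a proper metric space, a set of measures with bounded `p`-th moments is tight. -/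
theorem isTightMeasureSet_of_moment_le {X : Type*} [PseudoMetricSpace X] [ProperSpace X]
    [MeasurableSpace X] [BorelSpace X] {S : Set (Measure X)} {p : ℝ} (hp : 0 < p) (ζ : X)
    {K : ℝ≥0∞} (hK : K ≠ ∞)
    (hS : ∀ μ ∈ S, ∫⁻ x, ENNReal.ofReal (dist ζ x ^ p) ∂μ ≤ K) : IsTightMeasureSet S := by
  rw [isTightMeasureSet_iff_exists_isCompact_measure_compl_le]
  intro ε hε
  set δ : ℝ≥0∞ := min ε 1
  have hδ : δ ≠ 0 := (lt_min hε one_pos).ne'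
  have hδ' : δ ≠ ∞ := ((min_le_right ε 1).trans_lt ENNReal.one_lt_top).ne
  -- Markov level: `K ≤ t * δ`. The `+ 1` keeps `t` nonzero when `K = 0`, so that it cancels.
  set t : ℝ≥0∞ := K / δ + 1
  have ht0 : t ≠ 0 := by simp [t]
  have ht : t ≠ ∞ := ENNReal.add_ne_top.2 ⟨ENNReal.div_ne_top hK hδ, ENNReal.one_ne_top⟩
  have hc : t ^ (1 / p) ≠ ∞ := ENNReal.rpow_ne_top_of_nonneg (by positivity) ht
  refine ⟨Metric.closedBall ζ (t ^ (1 / p)).toReal, isCompact_closedBall _ _, fun μ hμ => ?_⟩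
  have hsub : (Metric.closedBall ζ (t ^ (1 / p)).toReal)ᶜ ⊆ {x | t ≤ edist ζ x ^ p} := by
    intro x hx
    have hx' : (t ^ (1 / p)).toReal < dist ζ x := by simpa [dist_comm] using hx
    have h1 : t ^ (1 / p) ≤ edist ζ x := by
      rw [edist_dist]
      exact ENNReal.le_ofReal_iff_toReal_le hc dist_nonneg |>.2 hx'.le
    have h2 := ENNReal.rpow_le_rpow h1 hp.le
    rwa [← ENNReal.rpow_mul, one_div_mul_cancel hp.ne', ENNReal.rpow_one] at h2
  have hm := mul_meas_ge_le_lintegral (μ := μ) (f := fun x => edist ζ x ^ p)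
    (by fun_prop) t
  have hb : t * μ {x | t ≤ edist ζ x ^ p} ≤ t * δ := by
    calc t * μ {x | t ≤ edist ζ x ^ p} ≤ K := by
          refine hm.trans ?_
          simpa only [ofReal_dist_rpow hp.le] using hS μ hμ
      _ = K / δ * δ := (ENNReal.div_mul_cancel hδ hδ').symm
      _ ≤ t * δ := by gcongr; exact le_self_add
  exact (measure_mono hsub).trans
    (((ENNReal.mul_le_mul_iff_right ht0 ht).1 hb).trans (min_le_left _ _))

/-! ### Power inequalities and the extended expectation. -/

theorem add_rpow_le_two_rpow_mul {a b r : ℝ} (ha : 0 ≤ a) (hb : 0 ≤ b) (hr : 0 ≤ r) :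
    (a + b) ^ r ≤ 2 ^ r * (a ^ r + b ^ r) := by
  have hm : 0 ≤ max a b := le_max_of_le_left ha
  calc (a + b) ^ r ≤ (2 * max a b) ^ r := by
        gcongr
        linarith [le_max_left a b, le_max_right a b]
    _ = 2 ^ r * max a b ^ r := Real.mul_rpow two_pos.le hm
    _ ≤ 2 ^ r * (a ^ r + b ^ r) := by
        gcongr
        rcases max_choice a b with h | h <;> rw [h]
        · linarith [Real.rpow_nonneg hb r]
        · linarith [Real.rpow_nonneg ha r]

/-- Serves to change metric and base point together: `A` is the comparison constant of the metrics,
`B` accounts for the distance between base points. -/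
theorem exists_rpow_le_mul_one_add_rpow {A B r : ℝ} (hA : 0 < A) (hB : 0 ≤ B) (hr : 0 ≤ r) :
    ∃ M : ℝ, 0 < M ∧ ∀ x y : ℝ, 0 ≤ x → 0 ≤ y → x ≤ A * (B + y) →
      1 + x ^ r ≤ M * (1 + y ^ r) := by
  refine ⟨1 + A ^ r * 2 ^ r * (B ^ r + 1), by positivity, fun x y hx hy h => ?_⟩
  have hBr := Real.rpow_nonneg hB r
  have hyr := Real.rpow_nonneg hy r
  have h1 : x ^ r ≤ A ^ r * 2 ^ r * (B ^ r + y ^ r) := by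
    calc x ^ r ≤ (A * (B + y)) ^ r := by gcongr
      _ = A ^ r * (B + y) ^ r := Real.mul_rpow hA.le (by positivity)
      _ ≤ A ^ r * (2 ^ r * (B ^ r + y ^ r)) := by
          gcongr
          exact add_rpow_le_two_rpow_mul hB hy hr
      _ = _ := by ring
  have h2 : A ^ r * 2 ^ r * (B ^ r + y ^ r) ≤ A ^ r * 2 ^ r * ((B ^ r + 1) * (1 + y ^ r)) := by
    gcongr
    nlinarith [mul_nonneg hBr hyr]
  nlinarith

theorem lintegral_rpow_lt_top_of_le {X : Type*} [MeasurableSpace X] {P : Measure X}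
    [IsFiniteMeasure P] {f g : X → ℝ} {A B p : ℝ} (hA : 0 < A) (hB : 0 ≤ B) (hp : 0 ≤ p)
    (hf : ∀ x, 0 ≤ f x) (hg : ∀ x, 0 ≤ g x) (hfg : ∀ x, f x ≤ A * (B + g x))
    (hP : ∫⁻ x, ENNReal.ofReal (g x ^ p) ∂P < ∞) :
    ∫⁻ x, ENNReal.ofReal (f x ^ p) ∂P < ∞ := by
  obtain ⟨M, hM, hMb⟩ := exists_rpow_le_mul_one_add_rpow hA hB hp
  calc ∫⁻ x, ENNReal.ofReal (f x ^ p) ∂P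
      ≤ ∫⁻ x, ENNReal.ofReal M * (1 + ENNReal.ofReal (g x ^ p)) ∂P := by
        refine lintegral_mono fun x => ?_
        have hgp := Real.rpow_nonneg (hg x) p
        rw [← ENNReal.ofReal_one, ← ENNReal.ofReal_add zero_le_one hgp, ← ENNReal.ofReal_mul hM.le]
        exact ENNReal.ofReal_le_ofReal (by linarith [hMb _ _ (hf x) (hg x) (hfg x)])
    _ < ∞ := by
        rw [lintegral_const_mul' _ _ ENNReal.ofReal_ne_top, lintegral_add_left measurable_const]
        refine ENNReal.mul_lt_top ENNReal.ofReal_lt_top (ENNReal.add_lt_top.2 ⟨?_, hP⟩)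
        simp

theorem one_add_rpow_le_two_add_rpow {d r p : ℝ} (hd : 0 ≤ d) (hr : 0 ≤ r) (hrp : r < p) :
    1 + d ^ r ≤ 2 + d ^ p := by
  have hp := Real.rpow_nonneg hd p
  rcases le_total d 1 with h | h
  · linarith [Real.rpow_le_one hd h hr]
  · linarith [Real.rpow_le_rpow_of_exponent_le h hrp.le]

/-- Splitting off an integrable majorant `g` of `h` from the extended-real expectation of `h`. -/
theorem extExpectation_eq_sub {X : Type*} [MeasurableSpace X] {P : ProbabilityMeasure X} {g h : X → ℝ}
    (hg0 : ∀ x, 0 ≤ g x) (hg : Integrable g (P : Measure X)) (hh : Measurable h)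
    (hgm : Measurable g) (hhg : ∀ x, h x ≤ g x) :
    extExpectation P h = ((∫ x, g x ∂(P : Measure X) : ℝ) : EReal) +
      -((∫⁻ x, ENNReal.ofReal (g x - h x) ∂(P : Measure X) : ℝ≥0∞) : EReal) := by
  -- Integrated form of `h⁺ + (g - h) = g + h⁻`; having no subtraction of integrals, it survives
  -- infinite values.
  have hsum : (∫⁻ x, ENNReal.ofReal (h x) ∂(P : Measure X)) +
        ∫⁻ x, ENNReal.ofReal (g x - h x) ∂(P : Measure X) =
      (∫⁻ x, ENNReal.ofReal (g x) ∂(P : Measure X)) +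
        ∫⁻ x, ENNReal.ofReal (-h x) ∂(P : Measure X) := by
    rw [← lintegral_add_left hh.ennreal_ofReal, ← lintegral_add_left hgm.ennreal_ofReal]
    refine lintegral_congr fun x => ?_
    rcases le_total 0 (h x) with h0 | h0
    · rw [← ENNReal.ofReal_add h0 (sub_nonneg.2 (hhg x)), add_sub_cancel,
        ENNReal.ofReal_of_nonpos (neg_nonpos.2 h0), add_zero]
    · rw [ENNReal.ofReal_of_nonpos h0, zero_add, sub_eq_add_neg,
        ENNReal.ofReal_add (hg0 x) (neg_nonneg.2 h0)]
  have hgl : ∫⁻ x, ENNReal.ofReal (g x) ∂(P : Measure X) =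
      ENNReal.ofReal (∫ x, g x ∂(P : Measure X)) :=
    (ofReal_integral_eq_lintegral_ofReal hg (Eventually.of_forall hg0)).symm
  have hfin : ∫⁻ x, ENNReal.ofReal (h x) ∂(P : Measure X) ≠ ∞ := by
    refine ne_top_of_le_ne_top (b := ∫⁻ x, ENNReal.ofReal (g x) ∂(P : Measure X)) ?_
      (lintegral_mono fun x => ENNReal.ofReal_le_ofReal (hhg x))
    rw [hgl]
    exact ENNReal.ofReal_ne_top
  have hI : 0 ≤ ∫ x, g x ∂(P : Measure X) := integral_nonneg hg0
  unfold extExpectation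
  rw [hgl] at hsum
  generalize ∫⁻ x, ENNReal.ofReal (h x) ∂(P : Measure X) = a at *
  generalize ∫⁻ x, ENNReal.ofReal (g x - h x) ∂(P : Measure X) = d at *
  generalize ∫⁻ x, ENNReal.ofReal (-h x) ∂(P : Measure X) = e at *
  generalize ∫ x, g x ∂(P : Measure X) = I at *
  lift a to NNReal using hfin
  induction d using ENNReal.recTopCoe with
  | top =>
    rw [add_top, eq_comm, ENNReal.add_eq_top] at hsum
    have he : e = ∞ := hsum.resolve_left ENNReal.ofReal_ne_top
    rw [he]
    simp [sub_eq_add_neg]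
  | coe d =>
    have he : e ≠ ∞ := by
      rintro rfl
      rw [add_top] at hsum
      exact (ENNReal.add_ne_top.2 ⟨ENNReal.coe_ne_top, ENNReal.coe_ne_top⟩) hsum
    lift e to NNReal using he
    have hr : (a : ℝ) + d = I + e := by
      have := congrArg ENNReal.toReal hsum
      rwa [ENNReal.toReal_add ENNReal.coe_ne_top ENNReal.coe_ne_top,
        ENNReal.toReal_add ENNReal.ofReal_ne_top ENNReal.coe_ne_top,
        ENNReal.toReal_ofReal hI] at this
    have hr' : (a : ℝ) - e = I + -d := by linarith
    have := congrArg (fun x : ℝ => (x : EReal)) hr'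
    simpa only [EReal.coe_nnreal_eq_coe_real, EReal.coe_sub, EReal.coe_add, EReal.coe_neg] using this

/-! ### Expectations under a uniform moment bound. -/

section Moments

variable {X : Type*} [MetricSpace X] [MeasurableSpace X] [BorelSpace X]

theorem integrable_dist_rpow_of_lintegral_lt_top {p : ℝ} (ζ : X) {μ : Measure X}
    (hμ : ∫⁻ x, ENNReal.ofReal (dist ζ x ^ p) ∂μ < ∞) :
    Integrable (fun x => dist ζ x ^ p) μ := by
  have hm : AEStronglyMeasurable (fun x => dist ζ x ^ p) μ :=
    (Measurable.pow_const (by fun_prop) p).aestronglyMeasurable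
  exact (lintegral_ofReal_ne_top_iff_integrable hm
    (Eventually.of_forall fun x => Real.rpow_nonneg dist_nonneg p)).1 hμ.ne

theorem integrable_of_abs_le_growth {p r C : ℝ} (hr : 0 ≤ r) (hrp : r < p) (hC : 0 < C) (ζ : X)
    {μ : Measure X} [IsFiniteMeasure μ]
    (hμ : ∫⁻ x, ENNReal.ofReal (dist ζ x ^ p) ∂μ < ∞) {g : X → ℝ} (hg : Measurable g)
    (hgC : ∀ x, |g x| ≤ C * (1 + dist ζ x ^ r)) : Integrable g μ := by
  have h1 := integrable_dist_rpow_of_lintegral_lt_top ζ hμ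
  refine (((integrable_const (2 : ℝ)).add h1).const_mul C).mono' hg.aestronglyMeasurable
    (Eventually.of_forall fun x => ?_)
  refine (hgC x).trans ?_
  simp only [Pi.add_apply]
  gcongr C * ?_
  exact one_add_rpow_le_two_add_rpow dist_nonneg hr hrp

/-- A continuous function of growth of order `r < p` has an expectation that depends continuously
on the distribution, on sets of distributions with bounded `p`-th moments. -/
theorem continuousOn_integral_of_moment_le {p r C : ℝ} (hr : 0 ≤ r) (hrp : r < p) (hC : 0 < C)
    (ζ : X) {S : Set (ProbabilityMeasure X)} {K : ℝ≥0∞} (hK : K ≠ ∞)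
    (hS : ∀ P ∈ S, ∫⁻ x, ENNReal.ofReal (dist ζ x ^ p) ∂(P : Measure X) ≤ K)
    {g : X → ℝ} (hg : Continuous g) (hgC : ∀ x, |g x| ≤ C * (1 + dist ζ x ^ r)) :
    ContinuousOn (fun P : ProbabilityMeasure X => ∫ x, g x ∂(P : Measure X)) S := by
  -- Continuous cut-off: `1` on the ball of radius `N`, `0` beyond radius `N + 1`.
  set φ : ℕ → X → ℝ := fun N x => max 0 (min 1 (N + 1 - dist ζ x))
  have hφ0 : ∀ N x, 0 ≤ φ N x := fun N x => le_max_left _ _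
  have hφ1 : ∀ N x, φ N x ≤ 1 := fun N x => max_le zero_le_one (min_le_left _ _)
  have hφc : ∀ N, Continuous (φ N) := fun N => by fun_prop
  have hbound : ∀ N x, ‖φ N x * g x‖ ≤ C * (1 + (N + 1 : ℝ) ^ r) := by
    intro N x
    rw [norm_mul, Real.norm_of_nonneg (hφ0 N x), Real.norm_eq_abs]
    rcases le_total (dist ζ x) (N + 1) with h | h
    · calc φ N x * |g x| ≤ 1 * |g x| := by gcongr; exact hφ1 N x
        _ ≤ C * (1 + dist ζ x ^ r) := by rw [one_mul]; exact hgC x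
        _ ≤ _ := by gcongr
    · have : φ N x = 0 := max_eq_left ((min_le_right _ _).trans (by linarith))
      rw [this, zero_mul]
      positivity
  have hcont : ∀ N, Continuous fun P : ProbabilityMeasure X =>
      ∫ x, φ N x * g x ∂(P : Measure X) := fun N =>
    ProbabilityMeasure.continuous_integral_boundedContinuousFunction
      (BoundedContinuousFunction.ofNormedAddCommGroup (fun x => φ N x * g x)
        ((hφc N).mul hg) _ (hbound N))
  -- The error lives where `d > N ≥ 1`; there `1 + d^r ≤ 2 d^r = 2 d^(r-p) d^p`, and `r < p` gives
  -- `d^(r-p) ≤ N^(r-p)`.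
  have hpt : ∀ N : ℕ, 1 ≤ N → ∀ x,
      ‖g x - φ N x * g x‖ ≤ 2 * C * (N : ℝ) ^ (r - p) * dist ζ x ^ p := by
    intro N hN x
    have hN' : (1 : ℝ) ≤ N := by exact_mod_cast hN
    rcases le_or_gt (dist ζ x) N with h | h
    · have : φ N x = 1 := by
        simp only [φ]
        rw [min_eq_left (by linarith), max_eq_right zero_le_one]
      rw [this, one_mul, sub_self, norm_zero]
      positivity
    · have hd : 1 ≤ dist ζ x := hN'.trans h.le
      have hd0 : 0 < dist ζ x := one_pos.trans_le hd
      calc ‖g x - φ N x * g x‖ = (1 - φ N x) * |g x| := by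
            rw [← one_sub_mul, norm_mul, Real.norm_of_nonneg (by linarith [hφ1 N x]),
              Real.norm_eq_abs]
        _ ≤ 1 * |g x| := by gcongr; linarith [hφ0 N x]
        _ ≤ C * (1 + dist ζ x ^ r) := by rw [one_mul]; exact hgC x
        _ ≤ C * (dist ζ x ^ r + dist ζ x ^ r) := by
            gcongr
            exact Real.one_le_rpow hd hr
        _ = 2 * C * dist ζ x ^ (r - p) * dist ζ x ^ p := by
            rw [mul_assoc, ← Real.rpow_add hd0, sub_add_cancel]
            ring
        _ ≤ 2 * C * (N : ℝ) ^ (r - p) * dist ζ x ^ p := by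
            gcongr 2 * C * ?_ * dist ζ x ^ p
            exact Real.rpow_le_rpow_of_nonpos (by linarith) h.le (by linarith)
  -- Integrating the tail estimate gives an error `2 C N^(r-p) K`, the same for all `P ∈ S`.
  have hunif : TendstoUniformlyOn
      (fun (N : ℕ) (P : ProbabilityMeasure X) => ∫ x, φ N x * g x ∂(P : Measure X))
      (fun P => ∫ x, g x ∂(P : Measure X)) atTop S := by
    rw [Metric.tendstoUniformlyOn_iff]
    intro δ hδ
    have hlim : Tendsto (fun N : ℕ => 2 * C * (N : ℝ) ^ (r - p) * K.toReal) atTop (𝓝 0) := by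
      have h1 : Tendsto (fun N : ℕ => (N : ℝ) ^ (r - p)) atTop (𝓝 0) := by
        have := (tendsto_rpow_neg_atTop (y := p - r) (by linarith)).comp
          tendsto_natCast_atTop_atTop
        simpa [Function.comp_def, neg_sub] using this
      simpa using (h1.const_mul (2 * C)).mul_const K.toReal
    filter_upwards [hlim.eventually (gt_mem_nhds hδ), eventually_ge_atTop 1] with N hN hN1 P hP
    have hfin := (hS P hP).trans_lt hK.lt_top
    have hi := integrable_of_abs_le_growth hr hrp hC ζ hfin hg.measurable hgC
    have hi2 : Integrable (fun x => φ N x * g x) (P : Measure X) :=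
      Integrable.of_bound ((hφc N).mul hg).aestronglyMeasurable _ (Eventually.of_forall (hbound N))
    have hd := integrable_dist_rpow_of_lintegral_lt_top ζ hfin
    rw [dist_eq_norm, ← integral_sub hi hi2]
    refine lt_of_le_of_lt ?_ hN
    calc ‖∫ x, (g x - φ N x * g x) ∂(P : Measure X)‖
        ≤ ∫ x, 2 * C * (N : ℝ) ^ (r - p) * dist ζ x ^ p ∂(P : Measure X) :=
          norm_integral_le_of_norm_le (hd.const_mul _) (Eventually.of_forall (hpt N hN1))
      _ = 2 * C * (N : ℝ) ^ (r - p) * ∫ x, dist ζ x ^ p ∂(P : Measure X) :=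
          integral_const_mul _ _
      _ ≤ 2 * C * (N : ℝ) ^ (r - p) * K.toReal := by
          gcongr
          rw [integral_eq_lintegral_of_nonneg_ae
            (Eventually.of_forall fun x => Real.rpow_nonneg dist_nonneg p)
            hd.aestronglyMeasurable]
          exact ENNReal.toReal_mono hK (hS P hP)
  exact hunif.continuousOn (Frequently.of_forall fun N => (hcont N).continuousOn)

theorem upperSemicontinuousOn_extExpectation [SeparableSpace X] {p r C : ℝ} (hr : 0 ≤ r)
    (hrp : r < p) (hC : 0 < C) (ζ : X) {S : Set (ProbabilityMeasure X)} {K : ℝ≥0∞} (hK : K ≠ ∞)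
    (hS : ∀ P ∈ S, ∫⁻ x, ENNReal.ofReal (dist ζ x ^ p) ∂(P : Measure X) ≤ K)
    {h : X → ℝ} (hh : UpperSemicontinuous h) (hhC : ∀ x, h x ≤ C * (1 + dist ζ x ^ r)) :
    UpperSemicontinuousOn (fun P => extExpectation P h) S := by
  set g : X → ℝ := fun x => C * (1 + dist ζ x ^ r)
  have hg0 : ∀ x, 0 ≤ g x := fun x => by positivity
  have hgc : Continuous g :=
    continuous_const.mul (continuous_const.add
      ((continuous_const.dist continuous_id).rpow_const fun _ => Or.inr hr))
  have hgC : ∀ x, |g x| ≤ C * (1 + dist ζ x ^ r) := fun x => (abs_of_nonneg (hg0 x)).le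
  have heq : ∀ P ∈ S, extExpectation P h = ((∫ x, g x ∂(P : Measure X) : ℝ) : EReal) +
      -((∫⁻ x, ENNReal.ofReal (g x - h x) ∂(P : Measure X) : ℝ≥0∞) : EReal) := fun P hP =>
    extExpectation_eq_sub hg0 (integrable_of_abs_le_growth hr hrp hC ζ
      ((hS P hP).trans_lt hK.lt_top) hgc.measurable hgC) hh.measurable hgc.measurable hhC
  have hlsc : LowerSemicontinuous fun x => g x - h x := by
    have hn : LowerSemicontinuous fun x => -h x := fun x y hy => by
      filter_upwards [hh x (-y) (by linarith)] with z hz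
      linarith
    simpa [sub_eq_add_neg] using hgc.lowerSemicontinuous.add hn
  have hD := lowerSemicontinuous_lintegral_ofReal hlsc fun x => sub_nonneg.2 (hhC x)
  have hD' : UpperSemicontinuous fun P : ProbabilityMeasure X =>
      -((∫⁻ x, ENNReal.ofReal (g x - h x) ∂(P : Measure X) : ℝ≥0∞) : EReal) :=
    (continuous_neg.comp continuous_coe_ennreal_ereal).comp_lowerSemicontinuous_antitone hD
      fun a b hab => EReal.neg_le_neg_iff.2 (EReal.coe_ennreal_le_coe_ennreal_iff.2 hab)
  have hG := (continuous_coe_real_ereal.comp_continuousOn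
    (continuousOn_integral_of_moment_le hr hrp hC ζ hK hS hgc hgC)).upperSemicontinuousOn
  -- Addition in `EReal` is continuous here because the first summand is a real number.
  have hsum := hG.add' (hD'.upperSemicontinuousOn S) fun P _ =>
    EReal.continuousAt_add (Or.inl (EReal.coe_ne_top _)) (Or.inl (EReal.coe_ne_bot _))
  intro P hP y hy
  have h1 := hsum P hP y (by simpa [heq P hP] using hy)
  filter_upwards [h1, self_mem_nhdsWithin] with R hR hRS
  simpa [heq R hRS] using hR

end Moments

/-! ### Reduction to the maximum metric; compactness of the hyperrectangle. -/

section Product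

variable {n : ℕ} {Ξ : Fin n → Type*} [∀ k, MetricSpace (Ξ k)]

/-- The maximum metric on `Ξ`; the name keeps it apart from another metric in the context. -/
noncomputable abbrev maxDist (x y : (k : Fin n) → Ξ k) : ℝ := dist x y

theorem maxDist_nonneg (x y : (k : Fin n) → Ξ k) : 0 ≤ maxDist x y := dist_nonneg

theorem maxDist_triangle (x y z : (k : Fin n) → Ξ k) :
    maxDist x z ≤ maxDist x y + maxDist y z := dist_triangle x y z

theorem maxDist_le_productDist (q : ℝ≥0∞) (hq : 1 ≤ q) (x y : (k : Fin n) → Ξ k) :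
    maxDist x y ≤ productDist q x y := by
  have : Fact (1 ≤ q) := ⟨hq⟩
  simpa [productDist] using
    (PiLp.lipschitzWith_ofLp q Ξ).dist_le_mul (WithLp.toLp q x) (WithLp.toLp q y)

theorem exists_productDist_le (q : ℝ≥0∞) (hq : 1 ≤ q) :
    ∃ L : ℝ, 0 < L ∧ ∀ x y : (k : Fin n) → Ξ k, productDist q x y ≤ L * maxDist x y := by
  have : Fact (1 ≤ q) := ⟨hq⟩
  -- The `+ 1` secures positivity, since the Lipschitz constant can vanish when `n = 0`.
  refine ⟨((Fintype.card (Fin n) : NNReal) ^ (1 / q).toReal : NNReal) + 1, by positivity,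
    fun x y => ?_⟩
  have := (PiLp.antilipschitzWith_ofLp q Ξ).le_mul_dist (WithLp.toLp q x) (WithLp.toLp q y)
  refine this.trans ?_
  gcongr
  exact le_add_of_nonneg_right zero_le_one

/-- A metric equivalent to an `ℓ^q` product metric is equivalent to the maximum metric. -/
theorem EquivProductMetric.exists_bounds {ρ : MetricSpace ((k : Fin n) → Ξ k)}
    (h : EquivProductMetric ρ) :
    ∃ c C : ℝ, 0 < c ∧ 0 < C ∧
      ∀ x y, c * maxDist x y ≤ ρ.dist x y ∧ ρ.dist x y ≤ C * maxDist x y := by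
  obtain ⟨q, hq, c, C, hc, hC, H⟩ := h
  obtain ⟨L, hL, HL⟩ := exists_productDist_le (Ξ := Ξ) q hq
  refine ⟨c, C * L, hc, by positivity, fun x y => ⟨?_, ?_⟩⟩
  · exact (mul_le_mul_of_nonneg_left (maxDist_le_productDist q hq x y) hc.le).trans (H x y).1
  · rw [mul_assoc]
    exact (H x y).2.trans (mul_le_mul_of_nonneg_left (HL x y) hC.le)

theorem GrowthUp.exists_dist_bound {ρ : MetricSpace ((k : Fin n) → Ξ k)}
    (hρ : EquivProductMetric ρ) {r : ℝ} (hr : 0 ≤ r) {h : ((k : Fin n) → Ξ k) → ℝ}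
    (hh : GrowthUp ρ r h) (ζ : (k : Fin n) → Ξ k) :
    ∃ C : ℝ, 0 < C ∧ ∀ ξ, h ξ ≤ C * (1 + maxDist ζ ξ ^ r) := by
  obtain ⟨c, A, -, hA, H⟩ := hρ.exists_bounds
  obtain ⟨D, hD, ζ', hζ'⟩ := hh
  obtain ⟨M, hM, hMb⟩ := exists_rpow_le_mul_one_add_rpow hA (maxDist_nonneg ζ' ζ) hr
  refine ⟨D * M, by positivity, fun ξ => (hζ' ξ).trans ?_⟩
  rw [mul_assoc]
  gcongr
  refine hMb _ _ (@dist_nonneg _ ρ.toPseudoMetricSpace ζ' ξ) (maxDist_nonneg ζ ξ) ?_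
  refine (H ζ' ξ).2.trans ?_
  gcongr
  exact maxDist_triangle _ _ _

theorem Growth.exists_abs_le {ρ : MetricSpace ((k : Fin n) → Ξ k)}
    (hρ : EquivProductMetric ρ) {r : ℝ} (hr : 0 ≤ r) {h : ((k : Fin n) → Ξ k) → ℝ}
    (hh : Growth ρ r h) (ζ : (k : Fin n) → Ξ k) :
    ∃ C : ℝ, 0 < C ∧ ∀ ξ, |h ξ| ≤ C * (1 + maxDist ζ ξ ^ r) := by
  obtain ⟨C₁, hC₁, h₁⟩ := hh.1.exists_dist_bound hρ hr ζ
  obtain ⟨C₂, hC₂, h₂⟩ := hh.2.exists_dist_bound hρ hr ζ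
  refine ⟨max C₁ C₂, lt_max_of_lt_left hC₁, fun ξ => abs_le'.2 ⟨(h₁ ξ).trans ?_, (h₂ ξ).trans ?_⟩⟩ <;>
    have := maxDist_nonneg ζ ξ
  · gcongr
    exact le_max_left _ _
  · gcongr
    exact le_max_right _ _

/-- The maximum is attained coordinatewise, so after taking `p`-th roots each coordinate is compared
with the sum containing it. This converts the `n` separate cost constraints into one bound on the
displacement. -/
theorem dist_rpow_le_sum {p : ℝ} (hp : 0 < p) (x y : (k : Fin n) → Ξ k) :
    dist x y ^ p ≤ ∑ k, dist (x k) (y k) ^ p := by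
  have hs : 0 ≤ ∑ k, dist (x k) (y k) ^ p :=
    Finset.sum_nonneg fun k _ => Real.rpow_nonneg dist_nonneg p
  rw [← Real.le_rpow_inv_iff_of_pos dist_nonneg hs hp]
  refine (dist_pi_le_iff (Real.rpow_nonneg hs _)).2 fun k => ?_
  rw [Real.le_rpow_inv_iff_of_pos dist_nonneg hs hp]
  exact Finset.single_le_sum (f := fun k => dist (x k) (y k) ^ p)
    (fun k _ => Real.rpow_nonneg dist_nonneg p) (Finset.mem_univ k)

variable [∀ k, MeasurableSpace (Ξ k)]

/-- The moment condition may be checked with the maximum metric, at any base point. -/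
theorem finiteMoment_iff {ρ : MetricSpace ((k : Fin n) → Ξ k)} (hρ : EquivProductMetric ρ)
    {p : ℝ} (hp : 0 ≤ p) (P : ProbabilityMeasure ((k : Fin n) → Ξ k)) (ζ : (k : Fin n) → Ξ k) :
    FiniteMoment ρ p P ↔
      ∫⁻ ξ, ENNReal.ofReal (maxDist ζ ξ ^ p) ∂(P : Measure ((k : Fin n) → Ξ k)) < ∞ := by
  obtain ⟨c, A, hc, hA, H⟩ := hρ.exists_bounds
  constructor
  · rintro ⟨ζ', hζ'⟩
    refine lintegral_rpow_lt_top_of_le (inv_pos.2 hc) (B := c * maxDist ζ ζ')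
      (mul_nonneg hc.le (maxDist_nonneg _ _)) hp
      (fun _ => maxDist_nonneg _ _) (fun x => @dist_nonneg _ ρ.toPseudoMetricSpace ζ' x) (fun x => ?_) hζ'
    rw [inv_mul_eq_div, le_div_iff₀ hc]
    have h1 := (H ζ' x).1
    have h2 := mul_le_mul_of_nonneg_left (maxDist_triangle ζ ζ' x) hc.le
    linarith
  · intro h
    refine ⟨ζ, lintegral_rpow_lt_top_of_le hA le_rfl hp
      (fun x => @dist_nonneg _ ρ.toPseudoMetricSpace ζ x) (fun _ => maxDist_nonneg _ _) (fun x => ?_) h⟩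
    simpa using (H ζ x).2

/-- The couplings whose second marginals form the multi-transport hyperrectangle. -/
def couplings (p : ℝ) (Q : ProbabilityMeasure ((k : Fin n) → Ξ k)) (ε : Fin n → ℝ) :
    Set (ProbabilityMeasure (((k : Fin n) → Ξ k) × ((k : Fin n) → Ξ k))) :=
  {π | π.map measurable_fst.aemeasurable = Q ∧
    ∀ k, ∫⁻ z, ENNReal.ofReal (dist (z.1 k) (z.2 k) ^ p)
      ∂(π : Measure (((k : Fin n) → Ξ k) × ((k : Fin n) → Ξ k))) ≤ ENNReal.ofReal (ε k ^ p)}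

theorem hyperrectangle_eq_image (p : ℝ) (Q : ProbabilityMeasure ((k : Fin n) → Ξ k))
    (ε : Fin n → ℝ) :
    hyperrectangle p Q ε =
      (fun π => ProbabilityMeasure.map π measurable_snd.aemeasurable) '' couplings p Q ε := by
  ext P
  constructor
  · rintro ⟨π, h1, h2, h3⟩
    exact ⟨π, ⟨h1, h3⟩, h2⟩
  · rintro ⟨π, ⟨h1, h3⟩, h2⟩
    exact ⟨π, h1, h2, h3⟩

variable [∀ k, ProperSpace (Ξ k)] [∀ k, BorelSpace (Ξ k)]

/-- The diagonal coupling has zero cost. Supplies nonemptiness for the maximization. -/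
theorem self_mem_hyperrectangle {p : ℝ} (hp : 0 < p)
    (Q : ProbabilityMeasure ((k : Fin n) → Ξ k)) (ε : Fin n → ℝ) :
    Q ∈ hyperrectangle p Q ε := by
  have hd : Measurable fun x : (k : Fin n) → Ξ k => (x, x) := by fun_prop
  refine ⟨Q.map hd.aemeasurable, ?_, ?_, fun k => ?_⟩
  · refine Subtype.ext ?_
    simp only [ProbabilityMeasure.val_eq_to_measure, ProbabilityMeasure.toMeasure_map]
    rw [Measure.map_map measurable_fst hd]
    exact Measure.map_id
  · refine Subtype.ext ?_
    simp only [ProbabilityMeasure.val_eq_to_measure, ProbabilityMeasure.toMeasure_map]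
    rw [Measure.map_map measurable_snd hd]
    exact Measure.map_id
  · rw [ProbabilityMeasure.toMeasure_map, lintegral_map _ hd]
    · simp [Real.zero_rpow hp.ne']
    · exact (Measurable.pow_const (by fun_prop) p).ennreal_ofReal

/-- Triangle inequality through `z.1`: the first leg is a moment of `Q`, the second is controlled by
the transport budgets. The bound does not depend on `π`. -/
theorem lintegral_dist_rpow_snd_le {p : ℝ} (hp : 0 < p)
    {Q : ProbabilityMeasure ((k : Fin n) → Ξ k)} {ε : Fin n → ℝ} (ζ : (k : Fin n) → Ξ k)
    {π : ProbabilityMeasure (((k : Fin n) → Ξ k) × ((k : Fin n) → Ξ k))}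
    (hπ : π ∈ couplings p Q ε) :
    ∫⁻ z, ENNReal.ofReal (dist ζ z.2 ^ p)
        ∂(π : Measure (((k : Fin n) → Ξ k) × ((k : Fin n) → Ξ k))) ≤
      ENNReal.ofReal (2 ^ p) *
        ((∫⁻ ξ, ENNReal.ofReal (dist ζ ξ ^ p) ∂(Q : Measure ((k : Fin n) → Ξ k))) +
          ∑ k, ENNReal.ofReal (ε k ^ p)) := by
  have hQ : ∫⁻ ξ, ENNReal.ofReal (dist ζ ξ ^ p) ∂(Q : Measure ((k : Fin n) → Ξ k)) =
      ∫⁻ z, ENNReal.ofReal (dist ζ z.1 ^ p)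
        ∂(π : Measure (((k : Fin n) → Ξ k) × ((k : Fin n) → Ξ k))) := by
    rw [← hπ.1, ProbabilityMeasure.toMeasure_map, lintegral_map _ measurable_fst]
    exact (Measurable.pow_const (by fun_prop) p).ennreal_ofReal
  have hm1 : Measurable fun z : ((k : Fin n) → Ξ k) × ((k : Fin n) → Ξ k) =>
      ENNReal.ofReal (dist ζ z.1 ^ p) := (Measurable.pow_const (by fun_prop) p).ennreal_ofReal
  have hm2 : ∀ k, Measurable fun z : ((k : Fin n) → Ξ k) × ((k : Fin n) → Ξ k) =>
      ENNReal.ofReal (dist (z.1 k) (z.2 k) ^ p) := fun k =>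
    (Measurable.pow_const (by fun_prop) p).ennreal_ofReal
  calc ∫⁻ z, ENNReal.ofReal (dist ζ z.2 ^ p)
        ∂(π : Measure (((k : Fin n) → Ξ k) × ((k : Fin n) → Ξ k)))
      ≤ ∫⁻ z, ENNReal.ofReal (2 ^ p) * (ENNReal.ofReal (dist ζ z.1 ^ p) +
          ∑ k, ENNReal.ofReal (dist (z.1 k) (z.2 k) ^ p))
        ∂(π : Measure (((k : Fin n) → Ξ k) × ((k : Fin n) → Ξ k))) := by
        refine lintegral_mono fun z => ?_
        rw [← ENNReal.ofReal_sum_of_nonneg fun k _ => Real.rpow_nonneg dist_nonneg p,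
          ← ENNReal.ofReal_add (Real.rpow_nonneg dist_nonneg p)
            (Finset.sum_nonneg fun k _ => Real.rpow_nonneg dist_nonneg p),
          ← ENNReal.ofReal_mul (by positivity)]
        refine ENNReal.ofReal_le_ofReal ?_
        calc dist ζ z.2 ^ p ≤ (dist ζ z.1 + dist z.1 z.2) ^ p := by
              gcongr
              exact dist_triangle _ _ _
          _ ≤ 2 ^ p * (dist ζ z.1 ^ p + dist z.1 z.2 ^ p) :=
              add_rpow_le_two_rpow_mul dist_nonneg dist_nonneg hp.le
          _ ≤ _ := by
              gcongr
              exact dist_rpow_le_sum hp _ _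
    _ = ENNReal.ofReal (2 ^ p) *
        ((∫⁻ ξ, ENNReal.ofReal (dist ζ ξ ^ p) ∂(Q : Measure ((k : Fin n) → Ξ k))) +
          ∑ k, ∫⁻ z, ENNReal.ofReal (dist (z.1 k) (z.2 k) ^ p)
            ∂(π : Measure (((k : Fin n) → Ξ k) × ((k : Fin n) → Ξ k)))) := by
        rw [lintegral_const_mul' _ _ ENNReal.ofReal_ne_top, lintegral_add_left hm1,
          lintegral_finsetSum _ fun k _ => hm2 k, hQ]
    _ ≤ _ := by
        gcongr with k
        exact hπ.2 k

theorem exists_moment_bound_hyperrectangle {p : ℝ} (hp : 0 < p)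
    {Q : ProbabilityMeasure ((k : Fin n) → Ξ k)} (ε : Fin n → ℝ) (ζ : (k : Fin n) → Ξ k)
    (hQ : ∫⁻ ξ, ENNReal.ofReal (dist ζ ξ ^ p) ∂(Q : Measure ((k : Fin n) → Ξ k)) < ∞) :
    ∃ K : ℝ≥0∞, K ≠ ∞ ∧ ∀ P ∈ hyperrectangle p Q ε,
      ∫⁻ ξ, ENNReal.ofReal (dist ζ ξ ^ p) ∂(P : Measure ((k : Fin n) → Ξ k)) ≤ K := by
  refine ⟨ENNReal.ofReal (2 ^ p) *
        ((∫⁻ ξ, ENNReal.ofReal (dist ζ ξ ^ p) ∂(Q : Measure ((k : Fin n) → Ξ k))) +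
          ∑ k, ENNReal.ofReal (ε k ^ p)), ?_, ?_⟩
  · refine ENNReal.mul_ne_top ENNReal.ofReal_ne_top (ENNReal.add_ne_top.2 ⟨hQ.ne, ?_⟩)
    exact (ENNReal.sum_lt_top.2 fun k _ => ENNReal.ofReal_lt_top).ne
  · rw [hyperrectangle_eq_image]
    rintro _ ⟨π, hπ, rfl⟩
    rw [ProbabilityMeasure.toMeasure_map, lintegral_map _ measurable_snd]
    · exact lintegral_dist_rpow_snd_le hp ζ hπ
    · exact (Measurable.pow_const (by fun_prop) p).ennreal_ofReal

/-- Taking marginals is weakly continuous, and each cost constraint is a sublevel set of a lower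
semicontinuous functional. -/
theorem isClosed_couplings {p : ℝ} (hp : 0 ≤ p)
    (Q : ProbabilityMeasure ((k : Fin n) → Ξ k)) (ε : Fin n → ℝ) :
    IsClosed (couplings p Q ε) := by
  have h1 : IsClosed {π : ProbabilityMeasure (((k : Fin n) → Ξ k) × ((k : Fin n) → Ξ k)) |
      π.map measurable_fst.aemeasurable = Q} :=
    isClosed_eq (ProbabilityMeasure.continuous_map continuous_fst) continuous_const
  have h2 : ∀ k, IsClosed {π : ProbabilityMeasure (((k : Fin n) → Ξ k) × ((k : Fin n) → Ξ k)) |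
      ∫⁻ z, ENNReal.ofReal (dist (z.1 k) (z.2 k) ^ p)
        ∂(π : Measure (((k : Fin n) → Ξ k) × ((k : Fin n) → Ξ k))) ≤ ENNReal.ofReal (ε k ^ p)} := by
    intro k
    have hc : Continuous fun z : ((k : Fin n) → Ξ k) × ((k : Fin n) → Ξ k) =>
        dist (z.1 k) (z.2 k) ^ p :=
      Continuous.rpow_const (by fun_prop) fun _ => Or.inr hp
    exact (lowerSemicontinuous_lintegral_ofReal hc.lowerSemicontinuous
      fun z => Real.rpow_nonneg dist_nonneg p).isClosed_preimage _
  have h3 := h1.inter (isClosed_iInter h2)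
  convert h3 using 1
  ext π
  simp [couplings]

theorem isCompact_couplings {p : ℝ} (hp : 0 < p)
    {Q : ProbabilityMeasure ((k : Fin n) → Ξ k)} (ε : Fin n → ℝ) (ζ : (k : Fin n) → Ξ k)
    (hQ : ∫⁻ ξ, ENNReal.ofReal (dist ζ ξ ^ p) ∂(Q : Measure ((k : Fin n) → Ξ k)) < ∞) :
    IsCompact (couplings p Q ε) := by
  rw [← (isClosed_couplings hp.le Q ε).closure_eq]
  refine isCompact_closure_of_isTightMeasureSet ?_
  obtain ⟨K, hK, hKb⟩ := exists_moment_bound_hyperrectangle hp ε ζ hQ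
  have hm : Measurable fun ξ : (k : Fin n) → Ξ k => ENNReal.ofReal (dist ζ ξ ^ p) :=
    (Measurable.pow_const (by fun_prop) p).ennreal_ofReal
  refine isTightMeasureSet_of_moment_le hp (ζ, ζ)
    (ENNReal.add_ne_top.2 ⟨hK, hK⟩) ?_
  rintro _ ⟨π, hπ, rfl⟩
  -- `Q` itself belongs to the hyperrectangle, so the same `K` bounds both marginals.
  have hQπ := hKb _ (self_mem_hyperrectangle hp Q ε)
  rw [← hπ.1, ProbabilityMeasure.toMeasure_map, lintegral_map hm measurable_fst] at hQπ
  have hPπ := hKb _ ((hyperrectangle_eq_image p Q ε).symm ▸ Set.mem_image_of_mem _ hπ)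
  rw [ProbabilityMeasure.toMeasure_map, lintegral_map hm measurable_snd] at hPπ
  refine le_trans ?_ (add_le_add hQπ hPπ)
  have hm1 : Measurable fun z : ((k : Fin n) → Ξ k) × ((k : Fin n) → Ξ k) =>
      ENNReal.ofReal (dist ζ z.1 ^ p) := hm.comp measurable_fst
  rw [← lintegral_add_left hm1]
  -- The distance on the product is a maximum, so its `p`-th power is one of the two summands.
  refine lintegral_mono fun z => ?_
  rcases max_choice (dist ζ z.1) (dist ζ z.2) with h | h
  · rw [Prod.dist_eq, h]
    exact le_self_add
  · rw [Prod.dist_eq, h]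
    exact le_add_self

/-- The multi-transport hyperrectangle is weakly compact. -/
theorem isCompact_hyperrectangle {p : ℝ} (hp : 0 < p)
    {Q : ProbabilityMeasure ((k : Fin n) → Ξ k)} (ε : Fin n → ℝ) (ζ : (k : Fin n) → Ξ k)
    (hQ : ∫⁻ ξ, ENNReal.ofReal (dist ζ ξ ^ p) ∂(Q : Measure ((k : Fin n) → Ξ k)) < ∞) :
    IsCompact (hyperrectangle p Q ε) := by
  rw [hyperrectangle_eq_image]
  exact (isCompact_couplings hp ε ζ hQ).image (ProbabilityMeasure.continuous_map continuous_snd)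

/-- Expectations of upper semicontinuous functions of growth of order `r < p` attain their
supremum over the multi-transport hyperrectangle. -/
theorem exists_extExpectation_eq_iSup {p r C : ℝ} (hr : 0 ≤ r) (hrp : r < p) (hC : 0 < C)
    {Q : ProbabilityMeasure ((k : Fin n) → Ξ k)} (ε : Fin n → ℝ) (ζ : (k : Fin n) → Ξ k)
    (hQ : ∫⁻ ξ, ENNReal.ofReal (maxDist ζ ξ ^ p) ∂(Q : Measure ((k : Fin n) → Ξ k)) < ∞)
    {h : ((k : Fin n) → Ξ k) → ℝ} (hh : UpperSemicontinuous h)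
    (hhC : ∀ ξ, h ξ ≤ C * (1 + maxDist ζ ξ ^ r)) :
    (∀ P ∈ hyperrectangle p Q ε,
      ∫⁻ ξ, ENNReal.ofReal (h ξ) ∂(P : Measure ((k : Fin n) → Ξ k)) < ∞) ∧
    ∃ Pstar ∈ hyperrectangle p Q ε,
      extExpectation Pstar h = ⨆ P ∈ hyperrectangle p Q ε, extExpectation P h := by
  have hp : 0 < p := hr.trans_lt hrp
  obtain ⟨K, hK, hKb⟩ := exists_moment_bound_hyperrectangle hp ε ζ hQ
  refine ⟨fun P hP => ?_, ?_⟩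
  · have hi : Integrable (fun ξ => C * (1 + dist ζ ξ ^ r)) (P : Measure ((k : Fin n) → Ξ k)) :=
      integrable_of_abs_le_growth hr hrp hC ζ ((hKb P hP).trans_lt hK.lt_top)
        (((Measurable.pow_const (by fun_prop) r).const_add 1).const_mul C)
        fun ξ => (abs_of_nonneg (by positivity)).le
    exact (lintegral_mono fun ξ => ENNReal.ofReal_le_ofReal (hhC ξ)).trans_lt hi.lintegral_lt_top
  · obtain ⟨P, hP, hmax⟩ :=
      (upperSemicontinuousOn_extExpectation hr hrp hC ζ hK hKb hh hhC).exists_isMaxOn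
        ⟨Q, self_mem_hyperrectangle hp Q ε⟩ (isCompact_hyperrectangle hp ε ζ hQ)
    exact ⟨P, hP, le_antisymm (le_iSup₂_of_le P hP le_rfl) (iSup₂_le fun R hR => hmax hR)⟩

theorem lintegral_maxDist_rpow_lt_top {p : ℝ} (hp : 0 < p)
    {Q : ProbabilityMeasure ((k : Fin n) → Ξ k)} {ε : Fin n → ℝ} (ζ : (k : Fin n) → Ξ k)
    (hQ : ∫⁻ ξ, ENNReal.ofReal (maxDist ζ ξ ^ p) ∂(Q : Measure ((k : Fin n) → Ξ k)) < ∞)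
    {P : ProbabilityMeasure ((k : Fin n) → Ξ k)} (hP : P ∈ hyperrectangle p Q ε) :
    ∫⁻ ξ, ENNReal.ofReal (maxDist ζ ξ ^ p) ∂(P : Measure ((k : Fin n) → Ξ k)) < ∞ := by
  obtain ⟨K, hK, hKb⟩ := exists_moment_bound_hyperrectangle hp ε ζ hQ
  exact (hKb P hP).trans_lt hK.lt_top

theorem integrable_of_abs_le_maxDist_growth {p r C : ℝ} (hr : 0 ≤ r) (hrp : r < p) (hC : 0 < C)
    (ζ : (k : Fin n) → Ξ k) {P : ProbabilityMeasure ((k : Fin n) → Ξ k)}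
    (hP : ∫⁻ ξ, ENNReal.ofReal (maxDist ζ ξ ^ p) ∂(P : Measure ((k : Fin n) → Ξ k)) < ∞)
    {h : ((k : Fin n) → Ξ k) → ℝ} (hh : Continuous h)
    (hhC : ∀ ξ, |h ξ| ≤ C * (1 + maxDist ζ ξ ^ r)) :
    Integrable h (P : Measure ((k : Fin n) → Ξ k)) :=
  integrable_of_abs_le_growth hr hrp hC ζ hP hh.measurable hhC

theorem continuousOn_integral_hyperrectangle {p r C : ℝ} (hr : 0 ≤ r) (hrp : r < p) (hC : 0 < C)
    {Q : ProbabilityMeasure ((k : Fin n) → Ξ k)} (ε : Fin n → ℝ) (ζ : (k : Fin n) → Ξ k)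
    (hQ : ∫⁻ ξ, ENNReal.ofReal (maxDist ζ ξ ^ p) ∂(Q : Measure ((k : Fin n) → Ξ k)) < ∞)
    {h : ((k : Fin n) → Ξ k) → ℝ} (hh : Continuous h)
    (hhC : ∀ ξ, |h ξ| ≤ C * (1 + maxDist ζ ξ ^ r)) :
    ContinuousOn (fun P : ProbabilityMeasure ((k : Fin n) → Ξ k) =>
      ∫ ξ, h ξ ∂(P : Measure ((k : Fin n) → Ξ k))) (hyperrectangle p Q ε) := by
  obtain ⟨K, hK, hKb⟩ := exists_moment_bound_hyperrectangle (hr.trans_lt hrp) ε ζ hQ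
  exact continuousOn_integral_of_moment_le hr hrp hC ζ hK hKb hh hhC

end Product

end MTH

/-! ### Assembly of the two statements. -/

theorem mainTheorem2 {n : ℕ} {Ξ : Fin n → Type*} [∀ k, MetricSpace (Ξ k)]
    [∀ k, ProperSpace (Ξ k)] [∀ k, MeasurableSpace (Ξ k)] [∀ k, BorelSpace (Ξ k)]
    (ρ : MetricSpace ((k : Fin n) → Ξ k)) (hρ : MTH.EquivProductMetric ρ)
    (p : ℝ) (hp : 1 ≤ p) (Q : ProbabilityMeasure ((k : Fin n) → Ξ k))
    (hQ : MTH.FiniteMoment ρ p Q) (ε : Fin n → ℝ) (hε : ∀ k, 0 ≤ ε k) :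
    (∀ (h : ((k : Fin n) → Ξ k) → ℝ) (r : ℝ), 0 ≤ r → r < p →
      MTH.GrowthUp ρ r h → UpperSemicontinuous h →
        (∀ P ∈ MTH.hyperrectangle p Q ε,
          ∫⁻ ξ, ENNReal.ofReal (h ξ) ∂(P : Measure ((k : Fin n) → Ξ k)) < ∞) ∧
        ∃ Pstar ∈ MTH.hyperrectangle p Q ε,
          MTH.extExpectation Pstar h =
            ⨆ P ∈ MTH.hyperrectangle p Q ε, MTH.extExpectation P h) ∧
    (∀ (h : ((k : Fin n) → Ξ k) → ℝ) (r : ℝ), 0 ≤ r → r < p →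
      MTH.Growth ρ r h → Continuous h →
        (∀ P : ProbabilityMeasure ((k : Fin n) → Ξ k), MTH.FiniteMoment ρ p P →
          Integrable h (P : Measure ((k : Fin n) → Ξ k))) ∧
        (∀ P ∈ MTH.hyperrectangle p Q ε, MTH.FiniteMoment ρ p P) ∧
        ContinuousOn
          (fun P : ProbabilityMeasure ((k : Fin n) → Ξ k) =>
            ∫ ξ, h ξ ∂(P : Measure ((k : Fin n) → Ξ k)))
          (MTH.hyperrectangle p Q ε)) := by
  have hp0 : 0 < p := one_pos.trans_le hp
  -- The moment condition on `Q` provides the base point used throughout.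
  obtain ⟨ζ⟩ : Nonempty ((k : Fin n) → Ξ k) := ⟨hQ.choose⟩
  have hQζ := (MTH.finiteMoment_iff hρ hp0.le Q ζ).1 hQ
  refine ⟨fun h r hr hrp hg hu => ?_, fun h r hr hrp hg hc => ⟨fun P hP => ?_, fun P hP => ?_, ?_⟩⟩
  · obtain ⟨C, hC, hhC⟩ := hg.exists_dist_bound hρ hr ζ
    exact MTH.exists_extExpectation_eq_iSup hr hrp hC ε ζ hQζ hu hhC
  · obtain ⟨C, hC, hhC⟩ := MTH.Growth.exists_abs_le hρ hr hg ζ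
    exact MTH.integrable_of_abs_le_maxDist_growth hr hrp hC ζ
      ((MTH.finiteMoment_iff hρ hp0.le P ζ).1 hP) hc hhC
  · exact (MTH.finiteMoment_iff hρ hp0.le P ζ).2 (MTH.lintegral_maxDist_rpow_lt_top hp0 ζ hQζ hP)
  · obtain ⟨C, hC, hhC⟩ := MTH.Growth.exists_abs_le hρ hr hg ζ
    exact MTH.continuousOn_integral_hyperrectangle hr hrp hC ε ζ hQζ hc hhC
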